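/- Let $X$ be a complex Banach space and let $\mathbb R^+=[0,\infty)$. Let $BUC_C(\mathbb R^+,X)$ be the space of bounded uniformly continuous functions $f:\mathbb R^+\to X$ with precompact range, equipped with the supremum norm, let $C_0(\mathbb R^+,X)\subset BUC_C(\mathbb R^+,X)$ be the subspace of those $f$ with $\lim_{s\to\infty}f(s)=0$, and let $\mathbb Y^C:=BUC_C(\mathbb R^+,X)/C_0(\mathbb R^+,X)$ with the quotient norm. A $C_0$-semigroup $(T(t))_{t\ge 0}$ on a Banach space is called analytic if, for some $\theta\in(0,\pi/2]$, it extends to the sector $\Delta=\{z\ne 0:|\arg z|<\theta\}$ in such a way that $z\mapsto T(z)$ is holomorphic on $\Delta$ in operator norm, $T(z+w)=T(z)T(w)$ for $z,w\in\Delta$, and $T(z)x\to x$ as $z\to 0$, $z\in\Delta$, for every vector $x$. Let $A$ be the generator of an analytic $C_0$-semigroup $(T(t))_{t\ge 0}$ on $X$. Then: 1. The multiplication operators $\bar T(t)$, $[\bar T(t)f](s):=T(t)f(s)$ for $s\ge 0$, form an analytic $C_0$-semigroup $(\bar T(t))_{t\ge0}$ on $BUC_C(\mathbb R^+,X)$.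 2. The operators $\tilde T(t)$ induced by $\bar T(t)$ on the quotient form an analytic $C_0$-semigroup on $\mathbb Y^C$. 3. The generator of $(\bar T(t))_{t\ge0}$ on $BUC_C(\mathbb R^+,X)$ is the operator $\bar A_T$ with domain $$D(\bar A_T)=\{f\in BUC_C(\mathbb R^+,X): f(s)\in D(A)\ \text{for all } s\ge 0,\ Af(\cdot)\in BUC_C(\mathbb R^+,X)\}$$ given by $(\bar A_T f)(s)=Af(s)$ for all $s\ge 0$. -/

import Mathlib

open Filter Topology
open scoped NNReal BoundedContinuousFunction

noncomputable section

/-! ### Semigroups of bounded linear operators and their generators -/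

section Semigroups

variable {E : Type*} [NormedAddCommGroup E] [NormedSpace ℂ E]

/-- `(T t)_{t ≥ 0}` is a strongly continuous semigroup of bounded linear operators. -/
structure IsC0Semigroup (T : ℝ≥0 → E →L[ℂ] E) : Prop where
  map_zero : T 0 = 1
  map_add : ∀ s t : ℝ≥0, T (s + t) = T s * T t
  tendsto_zero : ∀ x : E, Tendsto (fun t : ℝ≥0 => T t x) (𝓝[>] 0) (𝓝 x)

/-- The open sector `{z ≠ 0 : |arg z| < θ}` around the positive half line. -/
def openSector (θ : ℝ) : Set ℂ := {z : ℂ | z ≠ 0 ∧ |z.arg| < θ}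

/-- `(T t)_{t ≥ 0}` is an analytic C₀-semigroup: it is a C₀-semigroup which extends to an open sector
around the positive half line, and the extension is holomorphic for the operator norm, has the
semigroup property, and is strongly continuous at `0` within the sector. -/
def IsAnalyticC0Semigroup (T : ℝ≥0 → E →L[ℂ] E) : Prop :=
  IsC0Semigroup T ∧
    ∃ θ : ℝ, 0 < θ ∧ θ ≤ Real.pi / 2 ∧ ∃ S : ℂ → E →L[ℂ] E,
      (∀ t : ℝ≥0, S ((t : ℝ) : ℂ) = T t) ∧
      DifferentiableOn ℂ S (openSector θ) ∧
      (∀ z ∈ openSector θ, ∀ w ∈ openSector θ, S (z + w) = S z * S w) ∧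
      ∀ x : E, Tendsto (fun z : ℂ => S z x) (𝓝[openSector θ] 0) (𝓝 x)

/-- `y = lim_{t → 0+} (T(t) x - x) / t`. -/
def HasGeneratorLimit (T : ℝ≥0 → E →L[ℂ] E) (x y : E) : Prop :=
  Tendsto (fun t : ℝ≥0 => ((t : ℝ) : ℂ)⁻¹ • (T t x - x)) (𝓝[>] 0) (𝓝 y)

theorem HasGeneratorLimit.unique {T : ℝ≥0 → E →L[ℂ] E} {x y y' : E}
    (h : HasGeneratorLimit T x y) (h' : HasGeneratorLimit T x y') : y = y' :=
  tendsto_nhds_unique h h'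

theorem HasGeneratorLimit.add {T : ℝ≥0 → E →L[ℂ] E} {x x' y y' : E}
    (h : HasGeneratorLimit T x y) (h' : HasGeneratorLimit T x' y') :
    HasGeneratorLimit T (x + x') (y + y') := by
  refine (Tendsto.add h h').congr fun t => ?_
  rw [← smul_add, map_add, add_sub_add_comm]

theorem HasGeneratorLimit.smul {T : ℝ≥0 → E →L[ℂ] E} {x y : E} (c : ℂ)
    (h : HasGeneratorLimit T x y) : HasGeneratorLimit T (c • x) (c • y) := by
  refine (Tendsto.const_smul h c).congr fun t => ?_
  rw [map_smul, ← smul_sub, smul_comm]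

theorem HasGeneratorLimit.zero (T : ℝ≥0 → E →L[ℂ] E) : HasGeneratorLimit T 0 0 := by
  simp [HasGeneratorLimit]

/-- The infinitesimal generator of `(T t)_{t ≥ 0}`: its domain is the set of those `x` for which
`lim_{t → 0+} (T(t) x - x) / t` exists, and its value at such an `x` is that limit. -/
def generator (T : ℝ≥0 → E →L[ℂ] E) : E →ₗ.[ℂ] E where
  domain :=
    { carrier := {x | ∃ y, HasGeneratorLimit T x y}
      zero_mem' := ⟨0, HasGeneratorLimit.zero T⟩
      add_mem' := fun ⟨y, hy⟩ ⟨y', hy'⟩ => ⟨y + y', hy.add hy'⟩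
      smul_mem' := fun c _ ⟨y, hy⟩ => ⟨c • y, hy.smul c⟩ }
  toFun :=
    { toFun := fun x => Classical.choose x.2
      map_add' := fun x x' => (Classical.choose_spec (x + x').2).unique
        ((Classical.choose_spec x.2).add (Classical.choose_spec x'.2))
      map_smul' := fun c x => (Classical.choose_spec (c • x).2).unique
        ((Classical.choose_spec x.2).smul c) }

end Semigroups

/-! ### The function spaces -/

theorem uniformContinuous_of_tendsto_bcf {Z : Type*} [NormedAddCommGroup Z]
    {ι : Type*} {l : Filter ι} [l.NeBot]
    {F : ι → ℝ≥0 →ᵇ Z} {f : ℝ≥0 →ᵇ Z} (hF : ∀ i, UniformContinuous (F i))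
    (h : Tendsto F l (𝓝 f)) : UniformContinuous f :=
  (BoundedContinuousFunction.tendsto_iff_tendstoUniformly.1 h).uniformContinuous
    (Frequently.of_forall hF)

section Spaces

variable (X : Type*) [NormedAddCommGroup X] [NormedSpace ℂ X]

/-- `BUC_C(ℝ⁺, X)`: the bounded uniformly continuous functions `[0, ∞) → X` with precompact range,
as a subspace of the bounded continuous functions with the supremum norm. -/
def bucC : Submodule ℂ (ℝ≥0 →ᵇ X) where
  carrier := {f | UniformContinuous f ∧ IsCompact (closure (Set.range f))}
  zero_mem' := by
    refine ⟨uniformContinuous_const, ?_⟩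
    exact isCompact_singleton.closure_of_subset (Set.range_subset_iff.2 fun _ => rfl)
  add_mem' := by
    rintro f g ⟨hf, hf'⟩ ⟨hg, hg'⟩
    refine ⟨hf.add hg, (hf'.add hg').closure_of_subset (Set.range_subset_iff.2 fun t => ?_)⟩
    exact Set.add_mem_add (subset_closure ⟨t, rfl⟩) (subset_closure ⟨t, rfl⟩)
  smul_mem' := by
    rintro c f ⟨hf, hf'⟩
    refine ⟨hf.const_smul c, (hf'.image (continuous_const_smul c)).closure_of_subset
      (Set.range_subset_iff.2 fun t => ?_)⟩
    exact ⟨f t, subset_closure ⟨t, rfl⟩, rfl⟩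

/-- `C₀(ℝ⁺, X)`: the bounded uniformly continuous functions `[0, ∞) → X` that tend to `0` at `∞`. -/
def cZero : Submodule ℂ (ℝ≥0 →ᵇ X) where
  carrier := {f | UniformContinuous f ∧ Tendsto f atTop (𝓝 0)}
  zero_mem' := ⟨uniformContinuous_const, tendsto_const_nhds⟩
  add_mem' := by
    rintro f g ⟨hf, hf'⟩ ⟨hg, hg'⟩
    have h := hf'.add hg'
    rw [add_zero] at h
    exact ⟨hf.add hg, h⟩
  smul_mem' := by
    rintro c f ⟨hf, hf'⟩
    exact ⟨hf.const_smul c, by simpa using hf'.const_smul c⟩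

theorem isClosed_cZero : IsClosed (cZero X : Set (ℝ≥0 →ᵇ X)) := by
  refine IsSeqClosed.isClosed fun F f hF h => ?_
  refine ⟨uniformContinuous_of_tendsto_bcf (fun n => (hF n).1) h, ?_⟩
  exact (BoundedContinuousFunction.tendsto_iff_tendstoUniformly.1
    h).tendstoUniformlyOnFilter.mono_right le_top |>.tendsto_of_eventually_tendsto
      (Eventually.of_forall fun n => (hF n).2) tendsto_const_nhds

/-- A continuous function with a limit at `∞` has precompact range, so `C₀ ⊆ BUC_C`. -/
theorem cZero_le_bucC : cZero X ≤ bucC X := by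
  rintro f ⟨hf, hf'⟩
  refine ⟨hf, ?_⟩
  have h : Tendsto f (cocompact ℝ≥0) (𝓝 0) := hf'.mono_left (by simp)
  exact (h.isCompact_insert_range_of_cocompact f.continuous).closure_of_subset
    (Set.subset_insert _ _)

/-- `C₀(ℝ⁺, X)` as a subspace of `BUC_C(ℝ⁺, X)`. -/
def cZeroInBucC : Submodule ℂ (bucC X) := (cZero X).submoduleOf (bucC X)

instance isClosed_cZeroInBucC : IsClosed (cZeroInBucC X : Set (bucC X)) :=
  (isClosed_cZero X).preimage continuous_subtype_val

/-- The quotient space `Y^C = BUC_C(ℝ⁺, X) / C₀(ℝ⁺, X)` with the quotient norm. -/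
abbrev YC : Type _ := bucC X ⧸ cZeroInBucC X

theorem isClosed_bucC [CompleteSpace X] : IsClosed (bucC X : Set (ℝ≥0 →ᵇ X)) := by
  refine IsSeqClosed.isClosed fun F f hF h => ?_
  refine ⟨uniformContinuous_of_tendsto_bcf (fun n => (hF n).1) h, ?_⟩
  refine TotallyBounded.isCompact_of_isClosed (TotallyBounded.closure ?_) isClosed_closure
  rw [Metric.totallyBounded_iff]
  intro ε hε
  obtain ⟨n, hn⟩ := ((Metric.tendsto_nhds.1 h) (ε / 2) (half_pos hε)).exists
  obtain ⟨s, hs, hs'⟩ := Metric.totallyBounded_iff.1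
    ((hF n).2.totallyBounded.subset subset_closure) (ε / 2) (half_pos hε)
  refine ⟨s, hs, Set.range_subset_iff.2 fun t => ?_⟩
  obtain ⟨y, hy, hy'⟩ := Set.mem_iUnion₂.1 (hs' ⟨t, rfl⟩)
  refine Set.mem_iUnion₂.2 ⟨y, hy, ?_⟩
  have h1 : dist (f t) (F n t) < ε / 2 := by
    rw [dist_comm]
    exact (BoundedContinuousFunction.dist_coe_le_dist t).trans_lt hn
  have h2 : dist (F n t) y < ε / 2 := hy'
  have h3 := dist_triangle (f t) (F n t) y
  exact Metric.mem_ball.2 (by linarith)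

/-- `BUC_C(ℝ⁺, X)` is a Banach space, and hence so is `Y^C`. -/
instance completeSpace_bucC [CompleteSpace X] : CompleteSpace (bucC X) :=
  (isClosed_bucC X).completeSpace_coe

end Spaces

/-! ### Operators acting pointwise -/

section Pointwise

variable {X : Type*} [NormedAddCommGroup X] [NormedSpace ℂ X]

/-- The pointwise action `f ↦ B f(·)` of a bounded operator `B` maps `BUC_C` to itself. -/
theorem compLeft_mem_bucC (B : X →L[ℂ] X) {f : ℝ≥0 →ᵇ X} (hf : f ∈ bucC X) :
    B.compLeftContinuousBounded ℝ≥0 f ∈ bucC X := by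
  refine ⟨B.uniformContinuous.comp hf.1, (hf.2.image B.continuous).closure_of_subset
    (Set.range_subset_iff.2 fun t => ?_)⟩
  exact ⟨f t, subset_closure ⟨t, rfl⟩, rfl⟩

/-- The multiplication operator `f ↦ B f(·)` on `BUC_C(ℝ⁺, X)`. -/
def mulOp (B : X →L[ℂ] X) : bucC X →L[ℂ] bucC X :=
  ((B.compLeftContinuousBounded ℝ≥0).comp (bucC X).subtypeL).codRestrict (bucC X)
    fun f => compLeft_mem_bucC B f.2

@[simp]
theorem mulOp_apply (B : X →L[ℂ] X) (f : bucC X) (s : ℝ≥0) : (mulOp B f).1 s = B (f.1 s) := rfl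

theorem mulOp_mem_cZero (B : X →L[ℂ] X) {f : bucC X} (hf : f ∈ cZeroInBucC X) :
    mulOp B f ∈ cZeroInBucC X := by
  refine ⟨(mulOp B f).2.1, ?_⟩
  have h := (B.continuous.tendsto 0).comp hf.2
  rw [map_zero] at h
  exact h

/-- The operator induced by `mulOp B` on the quotient `Y^C`. -/
def inducedOp (B : X →L[ℂ] X) : YC X →L[ℂ] YC X :=
  (cZeroInBucC X).liftQL ((cZeroInBucC X).mkQL.comp (mulOp B)) fun _ hf =>
    (Submodule.Quotient.mk_eq_zero _).2 (mulOp_mem_cZero B hf)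

@[simp]
theorem inducedOp_mk (B : X →L[ℂ] X) (f : bucC X) :
    inducedOp B (Submodule.Quotient.mk f) = Submodule.Quotient.mk (mulOp B f) := rfl

/-- The pointwise operator on `BUC_C(ℝ⁺, X)` given by an (unbounded) operator `A` in `X`: its domain
consists of those `f ∈ BUC_C` for which `f(s) ∈ D(A)` for all `s` and the function `s ↦ A f(s)`
belongs to `BUC_C`, and it maps `f` to this function. -/
def pointwiseOp (A : X →ₗ.[ℂ] X) : bucC X →ₗ.[ℂ] bucC X where
  domain :=
    { carrier := {f | ∃ h : ∀ s, f.1 s ∈ A.domain, ∃ g : bucC X, ∀ s, g.1 s = A ⟨f.1 s, h s⟩}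
      zero_mem' := ⟨fun _ => A.domain.zero_mem, 0, fun _ => A.map_zero.symm⟩
      add_mem' := fun {f f'} ⟨h, g, hg⟩ ⟨h', g', hg'⟩ =>
        ⟨fun s => A.domain.add_mem (h s) (h' s), g + g', fun s => by
          have e := A.map_add ⟨f.1 s, h s⟩ ⟨f'.1 s, h' s⟩
          rw [← hg s, ← hg' s] at e
          exact e.symm⟩
      smul_mem' := fun c f ⟨h, g, hg⟩ =>
        ⟨fun s => A.domain.smul_mem c (h s), c • g, fun s => by
          have e := A.map_smul c ⟨f.1 s, h s⟩
          rw [← hg s] at e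
          exact e.symm⟩ }
  toFun :=
    { toFun := fun f => Classical.choose f.2.2
      map_add' := fun f f' => by
        apply Subtype.ext
        ext s
        have e := A.map_add ⟨f.1.1 s, f.2.1 s⟩ ⟨f'.1.1 s, f'.2.1 s⟩
        rw [← Classical.choose_spec f.2.2 s, ← Classical.choose_spec f'.2.2 s] at e
        exact (Classical.choose_spec (f + f').2.2 s).trans e
      map_smul' := fun c f => by
        apply Subtype.ext
        ext s
        have e := A.map_smul c ⟨f.1.1 s, f.2.1 s⟩
        rw [← Classical.choose_spec f.2.2 s] at e
        exact (Classical.choose_spec (c • f).2.2 s).trans e }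

theorem pointwiseOp_apply (A : X →ₗ.[ℂ] X) (f : (pointwiseOp A).domain) (s : ℝ≥0) :
    (pointwiseOp A f).1 s = A ⟨f.1.1 s, f.2.1 s⟩ :=
  Classical.choose_spec f.2.2 s

end Pointwise

end

open Set

noncomputable section

/-! ### Transfer of analytic semigroups to `BUC_C` and to its quotient. -/

section Multiplication

variable {X : Type*} [NormedAddCommGroup X] [NormedSpace ℂ X]

/-! The maps `B ↦ mulOp B` and `B ↦ inducedOp B` are contractive, linear and multiplicative, so
holomorphy in operator norm and the semigroup law pass from `T` to both new families. Only strong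
continuity at `0` needs an argument: it holds because strong convergence of uniformly bounded
operators is uniform on precompact sets, such as the range of `f` (`tendsto_mulOp`), and it descends
through the quotient map.

For the generator, the point is that pointwise limits of difference quotients are automatically
uniform in `s`. If `Af(s) = g(s)`, the difference quotient of `f(s)` differs from `g(s)` by at most
the supremum of `‖T(r)g(s) - g(s)‖` over `0 < r < t` (`HasGeneratorLimit.norm_sub_le`), and strong
continuity applied to `g ∈ BUC_C` makes this small for all `s` at once. -/

theorem norm_mulOp_le (B : X →L[ℂ] X) : ‖mulOp B‖ ≤ ‖B‖ := by
  refine ContinuousLinearMap.opNorm_le_bound _ (norm_nonneg _) fun f => ?_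
  refine (BoundedContinuousFunction.norm_le (by positivity)).2 fun s => ?_
  exact (B.le_opNorm _).trans
    (mul_le_mul_of_nonneg_left (f.1.norm_coe_le_norm s) (norm_nonneg _))

/-- `B ↦ mulOp B` as a bounded linear map. -/
def mulOpL : (X →L[ℂ] X) →L[ℂ] (bucC X →L[ℂ] bucC X) :=
  LinearMap.mkContinuous (E := X →L[ℂ] X) (F := bucC X →L[ℂ] bucC X) (σ := RingHom.id ℂ)
    { toFun := fun B => mulOp B
      map_add' := fun _ _ => rfl
      map_smul' := fun _ _ => rfl } 1 fun B => by
    rw [one_mul]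
    exact norm_mulOp_le B

/-- The space of bounded operators on a normed space, with the topology given by the norm. -/
abbrev BoundedEnd (E : Type*) [NormedAddCommGroup E] [NormedSpace ℂ E] : Type _ := E →L[ℂ] E

theorem norm_inducedOp_apply_le (B : X →L[ℂ] X) (y : YC X) : ‖inducedOp B y‖ ≤ ‖B‖ * ‖y‖ := by
  refine le_of_forall_pos_le_add fun ε hε => ?_
  -- The quotient norm is an infimum that need not be attained, hence a nearly optimal
  -- representative. The `+ 1` covers `B = 0`.
  obtain ⟨f, rfl, hf⟩ := Submodule.Quotient.norm_mk_lt (S := cZeroInBucC X) y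
    (show 0 < ε / (‖B‖ + 1) by positivity)
  rw [inducedOp_mk]
  have h1 : ‖(Submodule.Quotient.mk (mulOp B f) : YC X)‖ ≤ ‖mulOp B f‖ :=
    Submodule.Quotient.norm_mk_le _ _
  have h2 : ‖mulOp B f‖ ≤ ‖B‖ * ‖f‖ := (mulOp B).le_of_opNorm_le (norm_mulOp_le B) f
  have h3 : ‖B‖ * (ε / (‖B‖ + 1)) ≤ ε := by
    rw [mul_div_assoc', div_le_iff₀ (by positivity)]
    nlinarith [norm_nonneg B]
  have h4 := mul_le_mul_of_nonneg_left hf.le (norm_nonneg B)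
  rw [mul_add] at h4
  linarith

/-- `B ↦ inducedOp B` as a bounded linear map. -/
def inducedOpL : (X →L[ℂ] X) →L[ℂ] BoundedEnd (YC X) :=
  LinearMap.mkContinuous (E := X →L[ℂ] X) (F := BoundedEnd (YC X)) (σ := RingHom.id ℂ)
    { toFun := fun B => inducedOp B
      map_add' := fun B C => ContinuousLinearMap.ext fun y => by
        obtain ⟨f, rfl⟩ := Submodule.Quotient.mk_surjective _ y
        rfl
      map_smul' := fun c B => ContinuousLinearMap.ext fun y => by
        obtain ⟨f, rfl⟩ := Submodule.Quotient.mk_surjective _ y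
        rfl } 1 fun B => by
    rw [one_mul]
    exact ContinuousLinearMap.opNorm_le_bound _ (norm_nonneg _) (norm_inducedOp_apply_le B)

theorem mulOp_one : mulOp (1 : X →L[ℂ] X) = 1 := rfl

theorem mulOp_mul (B C : X →L[ℂ] X) : mulOp (B * C) = mulOp B * mulOp C := rfl

theorem inducedOp_one : inducedOp (1 : X →L[ℂ] X) = 1 := by
  ext y
  obtain ⟨f, rfl⟩ := Submodule.Quotient.mk_surjective _ y
  rfl

theorem inducedOp_mul (B C : X →L[ℂ] X) : inducedOp (B * C) = inducedOp B * inducedOp C := by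
  ext y
  obtain ⟨f, rfl⟩ := Submodule.Quotient.mk_surjective _ y
  rfl

/-- Strong convergence to the identity is uniform on precompact sets, so that it passes to the
multiplication operators on `BUC_C`. -/
theorem tendsto_mulOp [CompleteSpace X] {ι : Type*} {l : Filter ι} [l.IsCountablyGenerated]
    {F : ι → X →L[ℂ] X} (hF : ∀ x, Tendsto (fun i => F i x) l (𝓝 x)) (f : bucC X) :
    Tendsto (fun i => mulOp (F i) f) l (𝓝 f) := by
  -- Convergence along a general filter gives no uniform bound; a convergent sequence is bounded, so
  -- Banach–Steinhaus applies.
  refine tendsto_of_seq_tendsto fun u hu => ?_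
  have hu' : ∀ x, Tendsto (fun n => F (u n) x) atTop (𝓝 x) := fun x => (hF x).comp hu
  obtain ⟨C, hC⟩ : ∃ C, ∀ n, ‖F (u n)‖ ≤ C := banach_steinhaus fun x => by
    obtain ⟨C, hC⟩ := (hu' x).norm.bddAbove_range
    exact ⟨C, fun n => hC ⟨n, rfl⟩⟩
  have hC0 : 0 ≤ C := (norm_nonneg _).trans (hC 0)
  rw [Metric.tendsto_nhds]
  intro ε hε
  -- Replacing `f(s)` by a net point `y` costs `C * ‖f(s) - y‖` after applying the operator and
  -- `‖f(s) - y‖` before; this mesh keeps the sum within `ε / 4`.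
  have hδ : 0 < ε / (4 * (C + 1)) := by positivity
  obtain ⟨N, hN, hcover⟩ := Metric.totallyBounded_iff.1
    (f.2.2.totallyBounded.subset subset_closure) _ hδ
  have hev : ∀ᶠ n in atTop, ∀ y ∈ N, dist (F (u n) y) y < ε / 4 :=
    (eventually_all_finite hN).2 fun y _ => Metric.tendsto_nhds.1 (hu' y) _ (by positivity)
  filter_upwards [hev] with n hn
  refine lt_of_le_of_lt ?_ (half_lt_self hε)
  refine (BoundedContinuousFunction.dist_le (half_pos hε).le).2 fun s => ?_
  obtain ⟨y, hy, hy'⟩ := mem_iUnion₂.1 (hcover ⟨s, rfl⟩)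
  have h1 : ‖f.1 s - y‖ < ε / (4 * (C + 1)) := by simpa [dist_eq_norm] using hy'
  have h2 := hn y hy
  rw [dist_eq_norm] at h2
  have h3 : ‖F (u n) (f.1 s - y)‖ ≤ C * ‖f.1 s - y‖ := (F (u n)).le_of_opNorm_le (hC n) _
  have h4 : (C + 1) * ‖f.1 s - y‖ ≤ ε / 4 := by
    have h := (mul_lt_mul_of_pos_left h1 (by positivity : 0 < C + 1)).le
    have e : (C + 1) * (ε / (4 * (C + 1))) = ε / 4 := by
      field_simp
    rwa [e] at h
  have h5 : F (u n) (f.1 s) - f.1 s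
      = F (u n) (f.1 s - y) + (F (u n) y - y) - (f.1 s - y) := by
    rw [map_sub]
    abel
  rw [Function.comp_apply, mulOp_apply, dist_eq_norm, h5]
  have h6 := norm_sub_le (F (u n) (f.1 s - y) + (F (u n) y - y)) (f.1 s - y)
  have h7 := norm_add_le (F (u n) (f.1 s - y)) (F (u n) y - y)
  linarith

theorem tendsto_inducedOp [CompleteSpace X] {ι : Type*} {l : Filter ι} [l.IsCountablyGenerated]
    {F : ι → X →L[ℂ] X} (hF : ∀ x, Tendsto (fun i => F i x) l (𝓝 x)) (y : YC X) :
    Tendsto (fun i => inducedOp (F i) y) l (𝓝 y) := by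
  obtain ⟨f, rfl⟩ := Submodule.Quotient.mk_surjective _ y
  exact ((cZeroInBucC X).mkQL.continuous.tendsto f).comp (tendsto_mulOp hF f)

/-- A bounded multiplicative linear map between operator algebras that preserves strong convergence
to the identity maps analytic semigroups to analytic semigroups. -/
theorem IsAnalyticC0Semigroup.map {E : Type*} [NormedAddCommGroup E] [NormedSpace ℂ E]
    {T : ℝ≥0 → X →L[ℂ] X} (hT : IsAnalyticC0Semigroup T)
    (Φ : (X →L[ℂ] X) →L[ℂ] (E →L[ℂ] E)) (h_one : Φ 1 = 1)
    (h_mul : ∀ B C, Φ (B * C) = Φ B * Φ C)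
    (h_real : ∀ F : ℝ≥0 → X →L[ℂ] X, (∀ x, Tendsto (fun i => F i x) (𝓝[>] 0) (𝓝 x)) →
      ∀ y, Tendsto (fun i => Φ (F i) y) (𝓝[>] 0) (𝓝 y))
    (h_sector : ∀ (θ : ℝ) (F : ℂ → X →L[ℂ] X),
      (∀ x, Tendsto (fun z => F z x) (𝓝[openSector θ] 0) (𝓝 x)) →
      ∀ y, Tendsto (fun z => Φ (F z) y) (𝓝[openSector θ] 0) (𝓝 y)) :
    IsAnalyticC0Semigroup fun t => Φ (T t) := by
  obtain ⟨h0, θ, hθ, hθ', S, hS, hd, hm, hl⟩ := hT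
  refine ⟨⟨?_, fun s t => ?_, h_real T h0.tendsto_zero⟩, θ, hθ, hθ', fun z => Φ (S z),
    fun t => congrArg Φ (hS t), Φ.differentiable.comp_differentiableOn hd, fun z hz w hw => ?_,
    h_sector θ S hl⟩
  · rw [h0.map_zero, h_one]
  · rw [h0.map_add, h_mul]
  · exact (congrArg Φ (hm z hz w hw)).trans (h_mul _ _)

end Multiplication

/-! ### Identification of the generator on `BUC_C`. -/

section Generator

variable {X : Type*} [NormedAddCommGroup X] [NormedSpace ℂ X]

theorem hasGeneratorLimit_generator (T : ℝ≥0 → X →L[ℂ] X) (x : (generator T).domain) :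
    HasGeneratorLimit T x (generator T x) :=
  Classical.choose_spec x.2

theorem HasGeneratorLimit.mem_domain {T : ℝ≥0 → X →L[ℂ] X} {x y : X}
    (h : HasGeneratorLimit T x y) : x ∈ (generator T).domain :=
  ⟨y, h⟩

theorem HasGeneratorLimit.generator_apply {T : ℝ≥0 → X →L[ℂ] X} {x y : X}
    (h : HasGeneratorLimit T x y) (hx : x ∈ (generator T).domain) :
    generator T ⟨x, hx⟩ = y :=
  (hasGeneratorLimit_generator T ⟨x, hx⟩).unique h

/-- The orbits of an analytic C₀-semigroup are continuous on `[0, ∞)`. -/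
theorem IsAnalyticC0Semigroup.continuousOn_orbit {T : ℝ≥0 → X →L[ℂ] X}
    (hT : IsAnalyticC0Semigroup T) (x : X) :
    ContinuousOn (fun r : ℝ => T r.toNNReal x) (Ici 0) := by
  obtain ⟨h0, θ, hθ, -, S, hS, hd, -, -⟩ := hT
  intro r hr
  -- At `0` this is strong continuity; at `r > 0` it follows from norm continuity of the holomorphic
  -- extension.
  rcases (mem_Ici.1 hr).eq_or_lt with rfl | hr
  · rw [← continuousWithinAt_Ioi_iff_Ici, ContinuousWithinAt, Real.toNNReal_zero, h0.map_zero]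
    refine (h0.tendsto_zero x).comp (tendsto_nhdsWithin_iff.2 ⟨?_, ?_⟩)
    · have h := (continuous_real_toNNReal.tendsto 0).mono_left (nhdsWithin_le_nhds (s := Ioi 0))
      rwa [Real.toNNReal_zero] at h
    · filter_upwards [self_mem_nhdsWithin] with u hu using Real.toNNReal_pos.2 hu
  · refine ContinuousAt.continuousWithinAt ?_
    have h : ContinuousOn (fun u : ℝ => S (u : ℂ)) (Ioi 0) :=
      hd.continuousOn.comp Complex.continuous_ofReal.continuousOn fun u hu =>
        ⟨Complex.ofReal_ne_zero.2 (ne_of_gt hu), by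
          rwa [Complex.arg_ofReal_of_nonneg (le_of_lt hu), abs_zero]⟩
    have h' : ContinuousAt (fun u : ℝ => S (u : ℂ) x) r :=
      (h.continuousAt (Ioi_mem_nhds hr)).clm_apply continuousAt_const
    refine h'.congr ?_
    filter_upwards [Ioi_mem_nhds hr] with u hu
    rw [← hS, Real.coe_toNNReal _ (le_of_lt hu)]

/-- The orbit of a point in the domain of the generator is differentiable from the right. -/
theorem HasGeneratorLimit.hasDerivWithinAt {T : ℝ≥0 → X →L[ℂ] X} (hT : IsC0Semigroup T) {x y : X}
    (h : HasGeneratorLimit T x y) {r : ℝ} (hr : 0 ≤ r) :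
    HasDerivWithinAt (fun u : ℝ => T u.toNNReal x) (T r.toNNReal y) (Ici r) r := by
  rw [← hasDerivWithinAt_Ioi_iff_Ici, hasDerivWithinAt_iff_tendsto_slope' self_notMem_Ioi]
  have hτ : Tendsto (fun u : ℝ => (u - r).toNNReal) (𝓝[>] r) (𝓝[>] 0) := by
    refine tendsto_nhdsWithin_iff.2 ⟨?_, ?_⟩
    · have h : Continuous fun u : ℝ => (u - r).toNNReal := by fun_prop
      have h' := (h.tendsto r).mono_left (nhdsWithin_le_nhds (s := Ioi r))
      rwa [sub_self, Real.toNNReal_zero] at h'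
    · filter_upwards [self_mem_nhdsWithin] with u hu
      exact Real.toNNReal_pos.2 (sub_pos.2 hu)
  -- For `u > r`, `T(u)x - T(r)x = T(r)(T(u - r)x - x)`.
  refine (((T r.toNNReal).continuous.tendsto y).comp (h.comp hτ)).congr' ?_
  filter_upwards [self_mem_nhdsWithin] with u hu
  have hu' : 0 ≤ u - r := (sub_pos.2 hu).le
  have e : u.toNNReal = r.toNNReal + (u - r).toNNReal := by
    rw [← Real.toNNReal_add hr hu', add_sub_cancel]
  simp only [Function.comp_apply, slope_def_module]
  rw [e, hT.map_add, Real.coe_toNNReal _ hu', map_smul, map_sub, mul_apply_eq_comp,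
    ← Complex.ofReal_inv, Complex.coe_smul]

/-- The difference quotients of an orbit deviate from the derivative at `0` by no more than the
orbit of the derivative deviates from its starting point. -/
theorem HasGeneratorLimit.norm_sub_le {T : ℝ≥0 → X →L[ℂ] X} (hT : IsAnalyticC0Semigroup T)
    {x y : X} (h : HasGeneratorLimit T x y) {t : ℝ≥0} (ht : 0 < t) {ε : ℝ} (hε : 0 ≤ ε)
    (hy : ∀ r, 0 < r → r < t → ‖T r y - y‖ ≤ ε) :
    ‖((t : ℝ) : ℂ)⁻¹ • (T t x - x) - y‖ ≤ ε := by
  have ht' : (0 : ℝ) < t := ht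
  -- The mean value inequality for `u ↦ T(u)x - u • y`, whose right derivative is `T(u)y - y`,
  -- replaces integration of the orbit.
  have key := norm_image_sub_le_of_norm_deriv_right_le_segment
    (f := fun u : ℝ => T u.toNNReal x - u • y) (f' := fun u => T u.toNNReal y - y)
    (a := 0) (b := t) (C := ε)
    (((hT.continuousOn_orbit x).mono Icc_subset_Ici_self).sub (by fun_prop))
    (fun u hu => by
      have h1 := (hasDerivWithinAt_id u (Ici u)).smul_const y
      rw [one_smul] at h1
      exact (h.hasDerivWithinAt hT.1 hu.1).sub h1)
    (fun u hu => by
      -- `hy` says nothing at `r = 0`, but there the derivative vanishes.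
      rcases hu.1.eq_or_lt with rfl | hu0
      · simpa [hT.1.map_zero] using hε
      · exact hy _ (Real.toNNReal_pos.2 hu0) ((Real.toNNReal_lt_iff_lt_coe hu.1).2 hu.2))
    t (right_mem_Icc.2 ht'.le)
  simp only [Real.toNNReal_coe, Real.toNNReal_zero, hT.1.map_zero, one_apply_eq_self,
    zero_smul, sub_zero] at key
  have e : ((t : ℝ) : ℂ)⁻¹ • (T t x - x) - y = (t : ℝ)⁻¹ • (T t x - (t : ℝ) • y - x) := by
    rw [← Complex.ofReal_inv, Complex.coe_smul, sub_right_comm, smul_sub _ _ ((t : ℝ) • y),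
      inv_smul_smul₀ ht'.ne']
  rw [e, norm_smul, norm_inv, Real.norm_of_nonneg ht'.le, inv_mul_le_iff₀ ht', mul_comm]
  exact key

/-- Membership in the domain of the generator of the multiplication semigroup is a pointwise
condition. -/
theorem hasGeneratorLimit_mulOp_iff [CompleteSpace X] {T : ℝ≥0 → X →L[ℂ] X}
    (hT : IsAnalyticC0Semigroup T) {f g : bucC X} :
    HasGeneratorLimit (E := bucC X) (fun t => mulOp (T t)) f g ↔
      ∀ s, HasGeneratorLimit T (f.1 s) (g.1 s) := by
  refine ⟨fun h s => ?_, fun h => ?_⟩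
  · have hc : Continuous fun f : bucC X => f.1 s :=
      (continuous_eval_const (F := ℝ≥0 →ᵇ X) s).comp continuous_subtype_val
    exact (hc.tendsto g).comp h
  · refine Metric.tendsto_nhds.2 fun ε hε => ?_
    -- Applied to `g`, not `f`: the resulting `δ` is independent of `s`.
    have hg := Metric.tendsto_nhds.1 (tendsto_mulOp hT.1.tendsto_zero g) (ε / 2) (half_pos hε)
    obtain ⟨δ, hδ, hδg⟩ := (mem_nhdsGT_iff_exists_Ioo_subset' (zero_lt_one' ℝ≥0)).1 hg
    filter_upwards [Ioo_mem_nhdsGT hδ] with t ht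
    refine lt_of_le_of_lt ?_ (half_lt_self hε)
    refine (BoundedContinuousFunction.dist_le (half_pos hε).le).2 fun s => ?_
    rw [dist_eq_norm]
    refine (h s).norm_sub_le hT ht.1 (half_pos hε).le fun r hr hrt => ?_
    rw [← dist_eq_norm]
    exact (BoundedContinuousFunction.dist_coe_le_dist (f := (mulOp (T r) g).1) (g := g.1) s).trans
      (le_of_lt (hδg ⟨hr, hrt.trans ht.2⟩))

theorem generator_mulOp [CompleteSpace X] {T : ℝ≥0 → X →L[ℂ] X} (hT : IsAnalyticC0Semigroup T) :
    generator (E := bucC X) (fun t => mulOp (T t)) = pointwiseOp (generator T) := by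
  refine LinearPMap.ext (Submodule.ext fun f => ⟨?_, ?_⟩) fun f hf hf' => ?_
  · rintro ⟨g, hg⟩
    have h := (hasGeneratorLimit_mulOp_iff hT).1 hg
    exact ⟨fun s => (h s).mem_domain, g, fun s => ((h s).generator_apply _).symm⟩
  · rintro ⟨h, g, hg⟩
    refine ⟨g, (hasGeneratorLimit_mulOp_iff hT).2 fun s => ?_⟩
    rw [hg s]
    exact hasGeneratorLimit_generator T ⟨f.1 s, h s⟩
  · refine HasGeneratorLimit.generator_apply ((hasGeneratorLimit_mulOp_iff hT).2 fun s => ?_) hf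
    rw [pointwiseOp_apply]
    exact hasGeneratorLimit_generator T ⟨f.1 s, hf'.1 s⟩

end Generator

theorem proposition3p3 {X : Type*} [NormedAddCommGroup X] [NormedSpace ℂ X] [CompleteSpace X]
    (A : X →ₗ.[ℂ] X) (T : ℝ≥0 → X →L[ℂ] X) (hT : IsAnalyticC0Semigroup T)
    (hA : A = generator T) :
    IsAnalyticC0Semigroup (E := bucC X) (fun t => mulOp (T t)) ∧
      IsAnalyticC0Semigroup (E := YC X) (fun t => inducedOp (T t)) ∧
      generator (E := bucC X) (fun t => mulOp (T t)) = pointwiseOp A := by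
  subst hA
  exact ⟨hT.map mulOpL mulOp_one mulOp_mul (fun _ h => tendsto_mulOp h) fun _ _ h => tendsto_mulOp h,
    hT.map inducedOpL inducedOp_one inducedOp_mul (fun _ h => tendsto_inducedOp h)
      fun _ _ h => tendsto_inducedOp h,
    generator_mulOp hT⟩

end
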